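/- Let $G=(V,A)$ be a finite graph, either undirected (undirected model) or directed and acyclic (directed model). Each vertex $v$ carries a random variable $X_v$ with values in a finite set $\mathcal X_v$, and $X_S=(X_v)_{v\in S}$ for $S\subseteq V$. A probability distribution $\mathbb P$ on $\prod_{v}\mathcal X_v$ (for any choice of finite sets $\mathcal X_v$) factorizes on $G$ if $\mathbb P(x)=\frac1Z\prod_{K\in\mathcal C}\psi_K(x_K)$ for a constant $Z$, a collection $\mathcal C$ of cliques of $G$ and functions $\psi_K\ge 0$ (undirected model), respectively if $\mathbb P(x)=\prod_{v\in V}p_v(x_v\mid x_{\mathrm{prt}(v)})$ for conditional distributions $p_v$ of $v$ given its set of parents $\mathrm{prt}(v)$ (directed model). In the undirected model, $X\perp Y\mid M$ ($M$ separates $X$ and $Y$) means that every path between a vertex of $X$ and a vertex of $Y$, endpoints included, contains a vertex of $M$. In the directed model, $X\perp Y\mid M$ ($M$ d-separates $X$ and $Y$) means that no trail $v_0,\dots,v_k$ with $v_0\in X$, $v_k\in Y$ (consecutive vertices joined by an arc in either direction, $k\ge 0$) is active given $M$. Here $v_i$ is a v-structure of the trail if $0<i<k$ and $(v_{i-1},v_i),(v_{i+1},v_i)\in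 A$, and the trail is active given $M$ if no vertex of it that is not a v-structure is in $M$, and every v-structure of it is in $M$ or has a descendant in $M$. For sets of vertices $B,C,E$, the Markov blanket $\mathrm{mb}_C(B|E)$ of $B$ in $C$ given $E$ is the smallest $M\subseteq C$ such that $X_B$ and $X_{C\setminus(B\cup M)}$ are independent given $X_{M\cup E}$ for every distribution that factorizes on $G$, where smallest means that a set $M\subseteq C$ has this property if and only if $\mathrm{mb}_C(B|E)\subseteq M$. Proposition. Let $B,C,C',E\subseteq V$ be such that $B\cap(C\cup C')\subseteq E$ (for instance $B$ disjoint from $C\cup C'$). Then, in both undirected and directed models, $\mathrm{mb}_C(B|E)$ and $\mathrm{mb}_{C\cup C'}(B|E)$ exist, and $$\mathrm{mb}_{C\cup C'}(B|E)=\mathrm{mb}_C(B|E)\quad\Longleftrightarrow\quad C'\perp B\mid C\cup E .$$ -/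

import Mathlib

open scoped BigOperators

namespace GraphicalModel

section Probability

variable {V : Type*} [Fintype V] [DecidableEq V] {𝒳 : V → Type} [∀ v, Fintype (𝒳 v)]

/-- The probability of an event under the probability mass function `p` on the finite
product space `∏ v, 𝒳 v`. -/
noncomputable def prob (p : (∀ v, 𝒳 v) → ℝ) (S : Set (∀ v, 𝒳 v)) : ℝ :=
  ∑ x, S.indicator p x

/-- The event `X_S = a_S`; only the coordinates of `a` in `S` matter. -/
def coordEvent (S : Set V) (a : ∀ v, 𝒳 v) : Set (∀ v, 𝒳 v) :=
  {x | ∀ v ∈ S, x v = a v}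

/-- The random vectors `X_A` and `X_D` are independent given `X_M` under `p`:
`P(X_A = a, X_D = d, X_M = m) P(X_M = m) = P(X_A = a, X_M = m) P(X_D = d, X_M = m)`
for all values `a, d, m`. The sets may overlap. -/
def CondIndep (p : (∀ v, 𝒳 v) → ℝ) (A D M : Set V) : Prop :=
  ∀ a d m : ∀ v, 𝒳 v,
    prob p (coordEvent A a ∩ coordEvent D d ∩ coordEvent M m) * prob p (coordEvent M m) =
      prob p (coordEvent A a ∩ coordEvent M m) * prob p (coordEvent D d ∩ coordEvent M m)

end Probability

/-- A class of probability distributions of random vectors `(X_v)_{v ∈ V}`, where each `X_v`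
takes its values in an arbitrary finite set `𝒳 v`. -/
abbrev DistClass (V : Type*) : Type _ :=
  ∀ (𝒳 : V → Type) [∀ v, Fintype (𝒳 v)], ((∀ v, 𝒳 v) → ℝ) → Prop

section Blanket

variable {V : Type*} [Fintype V] [DecidableEq V]

/-- `X_A` is independent from `X_D` given `X_M` for any distribution of the class `𝓕`. -/
def Indep (𝓕 : DistClass V) (A D M : Set V) : Prop :=
  ∀ (𝒳 : V → Type) [∀ v, Fintype (𝒳 v)] (p : (∀ v, 𝒳 v) → ℝ), 𝓕 𝒳 p → CondIndep p A D M

/-- `N` is the Markov blanket of `B` in `C` given `E`: the smallest subset `M` of `C` with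
`X_B` independent from `X_{C \ (B ∪ M)}` given `X_{M ∪ E}` for any distribution of the class,
where smallest means that a subset `M` of `C` has this property if and only if `N ⊆ M`. -/
def IsMarkovBlanket (𝓕 : DistClass V) (B C E N : Set V) : Prop :=
  N ⊆ C ∧ ∀ M ⊆ C, Indep 𝓕 B (C \ (B ∪ M)) (M ∪ E) ↔ N ⊆ M

/-- The Markov blanket of `B` in `C` given `E`, as the intersection of all subsets `M` of `C`
that have the defining independence property (the only set that can satisfy
`IsMarkovBlanket 𝓕 B C E`). -/
def mb (𝓕 : DistClass V) (C B E : Set V) : Set V :=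
  ⋂₀ {M | M ⊆ C ∧ Indep 𝓕 B (C \ (B ∪ M)) (M ∪ E)}

/-- A Markov blanket, when it exists, is `mb`; in particular it is unique. -/
theorem IsMarkovBlanket.eq_mb {𝓕 : DistClass V} {B C E N : Set V}
    (h : IsMarkovBlanket 𝓕 B C E N) : N = mb 𝓕 C B E := by
  apply Set.Subset.antisymm
  · exact Set.subset_sInter fun M hM => (h.2 M hM.1).1 hM.2
  · exact Set.sInter_subset_of_mem ⟨h.1, (h.2 N h.1).2 (Set.Subset.refl N)⟩

end Blanket

section Undirected

variable {V : Type*} [Fintype V] [DecidableEq V]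

/-- `p` is a probability distribution that factorizes as an undirected graphical model on `G`:
`p x = (1 / Z) ∏_{K ∈ 𝒞} ψ_K(x_K)` for a collection `𝒞` of cliques and nonnegative `ψ_K`. -/
def UndirectedFactorizes (G : SimpleGraph V) : DistClass V := fun 𝒳 _ p =>
  p ∈ stdSimplex ℝ (∀ v, 𝒳 v) ∧
    ∃ (𝒞 : Finset (Set V)) (ψ : ∀ K : Set V, (∀ v : K, 𝒳 v) → ℝ) (Z : ℝ),
      (∀ K ∈ 𝒞, G.IsClique K) ∧ (∀ K ∈ 𝒞, ∀ y, 0 ≤ ψ K y) ∧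
        ∀ x, p x = 1 / Z * ∏ K ∈ 𝒞, ψ K (fun v => x v)

/-- `M` separates `X` and `Y`: every path between them (vertices may repeat, endpoints count)
meets `M`. -/
def Separated (G : SimpleGraph V) (X Y M : Set V) : Prop :=
  ∀ x ∈ X, ∀ y ∈ Y, ∀ P : G.Walk x y, ∃ v ∈ P.support, v ∈ M

end Undirected

section Directed

variable {V : Type*} [Fintype V] [DecidableEq V]

/-- The directed graph has no cycle (loops are cycles). -/
def Acyclic (G : Digraph V) : Prop := ∀ v, ¬ Relation.TransGen G.Adj v v

/-- `p` is a probability distribution that factorizes as a directed graphical model on `G`: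
`p x = ∏_v q_v(x_v, x_{prt v})` for conditional distributions `q_v` of `v` given its parents. -/
def DirectedFactorizes (G : Digraph V) : DistClass V := fun 𝒳 _ p =>
  p ∈ stdSimplex ℝ (∀ v, 𝒳 v) ∧
    ∃ q : ∀ v, 𝒳 v → (∀ u : {u // G.Adj u v}, 𝒳 u) → ℝ,
      (∀ v y, (fun a => q v a y) ∈ stdSimplex ℝ (𝒳 v)) ∧
        ∀ x, p x = ∏ v, q v (x v) (fun u => x u)

/-- The sequence `t 0, …, t k` is a trail: consecutive vertices are joined by an arc in one of
the two directions. The values of `t` beyond `k` play no role. -/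
def IsTrail (G : Digraph V) (k : ℕ) (t : ℕ → V) : Prop :=
  ∀ i < k, G.Adj (t i) (t (i + 1)) ∨ G.Adj (t (i + 1)) (t i)

/-- The `i`-th vertex of the trail `t 0, …, t k` is a v-structure. -/
def IsVStructure (G : Digraph V) (k : ℕ) (t : ℕ → V) (i : ℕ) : Prop :=
  0 < i ∧ i < k ∧ G.Adj (t (i - 1)) (t i) ∧ G.Adj (t (i + 1)) (t i)

/-- The trail `t 0, …, t k` is active given `M`: its vertices that are not v-structures
(endpoints included) are not in `M`, and each v-structure is in `M` or has a descendant
in `M`. -/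
def IsActive (G : Digraph V) (k : ℕ) (t : ℕ → V) (M : Set V) : Prop :=
  ∀ i ≤ k, (¬ IsVStructure G k t i → t i ∉ M) ∧
    (IsVStructure G k t i → ∃ m ∈ M, Relation.ReflTransGen G.Adj (t i) m)

/-- `M` d-separates `X` and `Y`: no trail between them is active given `M`. -/
def DSeparated (G : Digraph V) (X Y M : Set V) : Prop :=
  ∀ (k : ℕ) (t : ℕ → V), IsTrail G k t → t 0 ∈ X → t k ∈ Y → ¬ IsActive G k t M

end Directed

end GraphicalModel

open GraphicalModel

namespace GraphicalModel

/-! ### Markov blankets from an abstract notion of connection -/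

section Abstract

variable {V : Type*} [Fintype V] [DecidableEq V]

/-! In both models, independence of `X_B` and `X_D` given `X_M` throughout the class means that no
vertex of `D` is connected to `B` given `M`. The proposition needs only two exchange rules for this
connection. If `d` is connected given `M ∪ F`, then without observing `F` either `d` or some vertex
of `F` is connected (`shrink`). If `d` is connected given `M`, then observing `F` leaves it
connected, unless some `f ∈ F` is connected given `M` and the rest of `F` (`truncate`). The blanket
is then the set of `c ∈ C` connected given `(C \ {c}) ∪ E`, and the equivalence is formal
(`IsConnectivity.mb_union_eq_iff`).

It remains to show that walks (`Reach`) and active trails (`DConn`) are such connections. Soundness: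
the factors that involve a reached vertex involve only reached or observed ones, so the density
splits (`condIndep_of_factor`); in the directed model this holds after restriction to an ancestral
set. Completeness: a bit sent along the connection correlates its ends, and the support of the
distribution alone shows the dependence (`not_condIndep_of_support`). -/

theorem CondIndep.symm {𝒳 : V → Type} [∀ v, Fintype (𝒳 v)] {p : (∀ v, 𝒳 v) → ℝ} {A D M : Set V}
    (h : CondIndep p A D M) : CondIndep p D A M := by
  intro a d m
  rw [Set.inter_comm (coordEvent D a), h d a m, mul_comm]

theorem Indep.symm {𝓕 : DistClass V} {A D M : Set V} (h : Indep 𝓕 A D M) : Indep 𝓕 D A M :=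
  fun 𝒳 _ p hp => (h 𝒳 p hp).symm

/-- `Conn M d` (to be read as "`d` is connected to `B` given `M`") describes the independences of
`X_B` in the class `𝓕` and obeys the exchange rules of graph separation. -/
structure IsConnectivity (𝓕 : DistClass V) (B : Set V) (Conn : Set V → V → Prop) : Prop where
  indep_iff : ∀ D M, Indep 𝓕 B D M ↔ ∀ d ∈ D, ¬ Conn M d
  notMem : ∀ {M d}, Conn M d → d ∉ M
  shrink : ∀ {M F d}, Conn (M ∪ F) d → Conn M d ∨ ∃ f ∈ F, Conn M f
  truncate : ∀ {M d} (F), Conn M d → (∃ f ∈ F, Conn (M ∪ (F \ {f})) f) ∨ Conn (M ∪ F) d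

namespace IsConnectivity

variable {𝓕 : DistClass V} {B C C' E : Set V} {Conn : Set V → V → Prop}

/-- The hypothesis on `B ∩ C` makes the vertices of `B` in `C` observed, hence never connected, so
that removing `B` from `C \ (B ∪ M)` loses nothing. -/
theorem isMarkovBlanket (h : IsConnectivity 𝓕 B Conn) (hB : B ∩ C ⊆ E) :
    IsMarkovBlanket 𝓕 B C E (mb 𝓕 C B E) := by
  have key : IsMarkovBlanket 𝓕 B C E {c ∈ C | Conn ((C \ {c}) ∪ E) c} := by
    refine ⟨Set.sep_subset _ _, fun M hM => ?_⟩
    rw [h.indep_iff]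
    constructor
    · rintro hd c ⟨hc, hcc⟩
      by_contra hcM
      have aux : ∀ f ∈ C, f ∉ M → ¬ Conn (M ∪ E) f := fun f hf hfM hconn =>
        hd f ⟨hf, fun hfB => hfB.elim (fun hfB => h.notMem hconn (Or.inr (hB ⟨hfB, hf⟩))) hfM⟩
          hconn
      -- Forgetting all of `C \ M` except `c` leaves some vertex of `C \ M` connected given `M ∪ E`.
      have e : (C \ {c}) ∪ E = (M ∪ E) ∪ ((C \ M) \ {c}) := by
        ext v
        have := @hM v
        by_cases hv : v = c
        · subst hv; simp [hcM]
        · simp only [Set.mem_union, Set.mem_sdiff, Set.mem_singleton_iff]; tauto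
      rw [e] at hcc
      rcases h.shrink hcc with h1 | ⟨f, hf, h1⟩
      · exact aux c hc hcM h1
      · exact aux f hf.1.1 hf.1.2 h1
    · rintro hN d ⟨hd, hdM⟩ hconn
      -- Observing the rest of `C` either exhibits a blanket vertex outside `M` or leaves the
      -- observed `d` connected; both are absurd.
      rcases h.truncate (C \ M) hconn with ⟨f, hf, h1⟩ | h1
      · have e : (M ∪ E) ∪ ((C \ M) \ {f}) = (C \ {f}) ∪ E := by
          ext v
          have := @hM v
          by_cases hv : v = f
          · subst hv; simp [hf.2]
          · simp only [Set.mem_union, Set.mem_sdiff, Set.mem_singleton_iff]; tauto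
        rw [e] at h1
        exact hf.2 (hN ⟨hf.1, h1⟩)
      · exact h.notMem h1 (Or.inr ⟨hd, fun hh => hdM (Or.inr hh)⟩)
  rw [← key.eq_mb]
  exact key

theorem mb_union_eq_iff (h : IsConnectivity 𝓕 B Conn) (hB : B ∩ (C ∪ C') ⊆ E) :
    mb 𝓕 (C ∪ C') B E = mb 𝓕 C B E ↔ Indep 𝓕 C' B (C ∪ E) := by
  have h1 := h.isMarkovBlanket (C := C) (E := E)
    (fun v hv => hB ⟨hv.1, Or.inl hv.2⟩)
  have h2 := h.isMarkovBlanket hB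
  have hE : ∀ {M v}, v ∈ C ∪ C' → Conn (M ∪ E) v → v ∉ B := fun hv hc hvB =>
    h.notMem hc (Or.inr (hB ⟨hvB, hv⟩))
  constructor
  · intro he
    have h3 := (h2.2 C Set.subset_union_left).2 (he ▸ h1.1)
    refine Indep.symm ((h.indep_iff _ _).2 fun d hd hc => ?_)
    exact (h.indep_iff _ _).1 h3 d
      ⟨Or.inr hd, fun hh => hh.elim (hE (Or.inr hd) hc) fun hdC => h.notMem hc (Or.inl hdC)⟩ hc
  · intro hs
    have hs' := (h.indep_iff _ _).1 hs.symm
    -- A connection to `C'` given `M ∪ E` either survives the observation of `C`, against the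
    -- separation, or yields one to `C` given `M ∪ E`.
    have good : ∀ M ⊆ C, Indep 𝓕 B (C \ (B ∪ M)) (M ∪ E) →
        Indep 𝓕 B ((C ∪ C') \ (B ∪ M)) (M ∪ E) := by
      intro M hM hi
      rw [h.indep_iff] at hi ⊢
      have hi' : ∀ f ∈ C, ¬ Conn (M ∪ E) f := fun f hf hc =>
        hi f ⟨hf, fun hh => hh.elim (hE (Or.inl hf) hc) fun hfM => h.notMem hc (Or.inl hfM)⟩ hc
      rintro d ⟨hd, -⟩ hc
      rcases h.truncate C hc with ⟨f, hf, h3⟩ | h3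
      · rcases h.shrink h3 with h4 | ⟨g, hg, h4⟩
        · exact hi' f hf h4
        · exact hi' g hg.1 h4
      · have e : M ∪ E ∪ C = C ∪ E := by
          ext v
          have := @hM v
          simp only [Set.mem_union]; tauto
        rw [e] at h3
        exact hd.elim (fun hd => h.notMem h3 (Or.inl hd)) fun hd => hs' d hd h3
    have hsub : mb 𝓕 (C ∪ C') B E ⊆ mb 𝓕 C B E :=
      (h2.2 _ (h1.1.trans Set.subset_union_left)).1
        (good _ h1.1 ((h1.2 _ h1.1).2 subset_rfl))
    refine hsub.antisymm ((h1.2 _ (hsub.trans h1.1)).1 ?_)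
    have h3 := (h2.2 _ h2.1).2 subset_rfl
    rw [h.indep_iff] at h3 ⊢
    exact fun d hd => h3 d ⟨Or.inl hd.1, hd.2⟩

end IsConnectivity

end Abstract

/-! ### Exchanging coordinates of two configurations -/

section Swap

variable {V : Type*} {𝒳 : V → Type}

/-- Exchange of the coordinates in `U` of two configurations. -/
noncomputable def swapOn (U : Set V) (z : (∀ v, 𝒳 v) × (∀ v, 𝒳 v)) :
    (∀ v, 𝒳 v) × (∀ v, 𝒳 v) :=
  open scoped Classical in
  (fun v => if v ∈ U then z.2 v else z.1 v, fun v => if v ∈ U then z.1 v else z.2 v)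

theorem swapOn_involutive (U : Set V) :
    Function.Involutive (swapOn U : (∀ v, 𝒳 v) × (∀ v, 𝒳 v) → _) := by
  rintro ⟨x, y⟩
  apply Prod.ext <;> funext v <;> by_cases hv : v ∈ U <;> simp [swapOn, hv]

end Swap

/-! ### Criteria for conditional independence and dependence -/

section Probability

variable {V : Type*} [Fintype V] [DecidableEq V] {𝒳 : V → Type} [∀ v, Fintype (𝒳 v)]

theorem prob_ne_zero_iff {p : (∀ v, 𝒳 v) → ℝ} (hp : ∀ x, 0 ≤ p x) {S : Set (∀ v, 𝒳 v)} :
    prob p S ≠ 0 ↔ ∃ x ∈ S, p x ≠ 0 := by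
  classical
  unfold prob
  rw [Ne, Finset.sum_eq_zero_iff_of_nonneg fun x _ => Set.indicator_nonneg (fun x _ => hp x) x]
  simp only [Finset.mem_univ, true_implies, not_forall, Set.indicator_apply_eq_zero, exists_prop]

/-- The values of `x` on `A` and of `y` on `D` are each possible given the common value on `M`, but
not jointly: one side of the product formula vanishes and the other does not. -/
theorem not_condIndep_of_support {p : (∀ v, 𝒳 v) → ℝ} (hp : ∀ x, 0 ≤ p x) {A D M : Set V}
    {a d : V} (ha : a ∈ A) (hd : d ∈ D) {x y : ∀ v, 𝒳 v} (hx : p x ≠ 0) (hy : p y ≠ 0)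
    (hxy : ∀ v ∈ M, x v = y v)
    (h : ∀ z, p z ≠ 0 → (∀ v ∈ M, z v = y v) → z a = x a → z d ≠ y d) :
    ¬ CondIndep p A D M := by
  intro hc
  have h0 : prob p (coordEvent A x ∩ coordEvent D y ∩ coordEvent M y) = 0 := by
    by_contra hne
    obtain ⟨z, ⟨⟨hzA, hzD⟩, hzM⟩, hz⟩ := (prob_ne_zero_iff hp).1 hne
    exact h z hz hzM (hzA a ha) (hzD d hd)
  have := hc x y y
  rw [h0, zero_mul] at this
  have h1 : prob p (coordEvent A x ∩ coordEvent M y) ≠ 0 :=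
    (prob_ne_zero_iff hp).2 ⟨x, ⟨fun _ _ => rfl, hxy⟩, hx⟩
  have h2 : prob p (coordEvent D y ∩ coordEvent M y) ≠ 0 :=
    (prob_ne_zero_iff hp).2 ⟨y, ⟨fun _ _ => rfl, fun _ _ => rfl⟩, hy⟩
  exact mul_ne_zero h1 h2 this.symm

theorem prob_mul_prob (p : (∀ v, 𝒳 v) → ℝ) (S T : Set (∀ v, 𝒳 v)) :
    prob p S * prob p T = ∑ z : (∀ v, 𝒳 v) × (∀ v, 𝒳 v), S.indicator p z.1 * T.indicator p z.2 := by
  rw [prob, prob, Finset.sum_mul_sum, ← Finset.univ_product_univ, Finset.sum_product]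

/-- If `p` splits into a function of the coordinates in `U ∪ M` and a function of the coordinates
outside `U`, then the two blocks are independent given `M`. -/
theorem condIndep_of_factor {p f g : (∀ v, 𝒳 v) → ℝ} {A D M U : Set V}
    (hp : ∀ x, p x = f x * g x)
    (hf : ∀ x y, (∀ v ∈ U ∪ M, x v = y v) → f x = f y)
    (hg : ∀ x y, (∀ v ∉ U, x v = y v) → g x = g y)
    (hA : A ⊆ U ∪ M) (hD : Disjoint D U) (hM : Disjoint M U) : CondIndep p A D M := by
  classical
  intro a d m
  -- Both products are sums over pairs of configurations. Exchanging the coordinates in `U` matches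
  -- their terms: the event on `A` moves to the second configuration, the event on `D` stays with
  -- the first.
  rw [mul_comm (prob p (coordEvent A a ∩ _)), prob_mul_prob, prob_mul_prob]
  refine Fintype.sum_equiv (swapOn_involutive U).toPerm _ _ ?_
  rintro ⟨x, y⟩
  have hM' : ∀ v ∈ M, v ∉ U := fun v hv hU => Set.disjoint_left.1 hM hv hU
  have hD' : ∀ v ∈ D, v ∉ U := fun v hv hU => Set.disjoint_left.1 hD hv hU
  set x' := (swapOn U (x, y)).1 with hx'
  set y' := (swapOn U (x, y)).2 with hy'
  have hx_in : ∀ v ∈ U, x' v = y v := fun v hv => by simp [hx', swapOn, hv]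
  have hx_out : ∀ v ∉ U, x' v = x v := fun v hv => by simp [hx', swapOn, hv]
  have hy_in : ∀ v ∈ U, y' v = x v := fun v hv => by simp [hy', swapOn, hv]
  have hy_out : ∀ v ∉ U, y' v = y v := fun v hv => by simp [hy', swapOn, hv]
  change _ = (coordEvent D d ∩ coordEvent M m).indicator p x' *
    (coordEvent A a ∩ coordEvent M m).indicator p y'
  have xM : x ∈ coordEvent M m ↔ x' ∈ coordEvent M m :=
    forall₂_congr fun v hv => by rw [hx_out v (hM' v hv)]
  have yM : y ∈ coordEvent M m ↔ y' ∈ coordEvent M m :=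
    forall₂_congr fun v hv => by rw [hy_out v (hM' v hv)]
  have xD : x ∈ coordEvent D d ↔ x' ∈ coordEvent D d :=
    forall₂_congr fun v hv => by rw [hx_out v (hD' v hv)]
  by_cases h1 : x ∈ coordEvent M m
  · by_cases h2 : y ∈ coordEvent M m
    · have e1 : ∀ v ∈ U ∪ M, x v = y' v := by
        rintro v (hv | hv)
        · rw [hy_in v hv]
        · rw [hy_out v (hM' v hv), h1 v hv, h2 v hv]
      have e2 : ∀ v ∈ U ∪ M, y v = x' v := by
        rintro v (hv | hv)
        · rw [hx_in v hv]
        · rw [hx_out v (hM' v hv), h1 v hv, h2 v hv]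
      have xA : x ∈ coordEvent A a ↔ y' ∈ coordEvent A a :=
        forall₂_congr fun v hv => by rw [e1 v (hA hv)]
      simp only [Set.indicator_apply, Set.mem_inter_iff, ← xM, ← yM, ← xD, ← xA, h1, h2, and_true]
      have e3 : p x * p y = p x' * p y' := by
        rw [hp, hp, hp, hp, hf x y' e1, hf y x' e2, hg x x' fun v hv => (hx_out v hv).symm,
          hg y y' fun v hv => (hy_out v hv).symm]
        ring
      by_cases h3 : x ∈ coordEvent A a <;> by_cases h4 : x ∈ coordEvent D d <;> simp [h3, h4, e3]
    · simp [Set.indicator_apply, ← yM, h2]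
  · simp [Set.indicator_apply, ← xM, h1]

theorem sum_sum_update (v : V) (F : (∀ v, 𝒳 v) → ℝ) :
    ∑ x, ∑ a, F (Function.update x v a) = Fintype.card (𝒳 v) * ∑ x, F x := by
  have hi : Function.Involutive fun z : (∀ v, 𝒳 v) × 𝒳 v => (Function.update z.1 v z.2, z.1 v) := by
    rintro ⟨x, a⟩; simp
  have : ∑ z : (∀ v, 𝒳 v) × 𝒳 v, F (Function.update z.1 v z.2)
      = ∑ z : (∀ v, 𝒳 v) × 𝒳 v, F z.1 :=
    Fintype.sum_equiv hi.toPerm _ _ fun z => rfl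
  rw [← Finset.univ_product_univ, Finset.sum_product, Finset.sum_product] at this
  rw [this]
  simp [Finset.mul_sum]

/-- A conditional distribution of the coordinate `v` may be replaced by the uniform one in a sum
whose other factor does not involve that coordinate. -/
theorem sum_mul_conditional (v : V) [Nonempty (𝒳 v)] {F Q : (∀ v, 𝒳 v) → ℝ}
    (hF : ∀ x a, F (Function.update x v a) = F x)
    (hQ : ∀ x, ∑ a, Q (Function.update x v a) = 1) :
    ∑ x, F x * Q x = ∑ x, F x * (Fintype.card (𝒳 v) : ℝ)⁻¹ := by
  have hc : (Fintype.card (𝒳 v) : ℝ) ≠ 0 := Nat.cast_ne_zero.2 Fintype.card_ne_zero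
  have := sum_sum_update v fun x => F x * Q x
  simp only [hF, ← Finset.mul_sum, hQ, mul_one] at this
  rw [← Finset.sum_mul, this]
  field_simp

end Probability

/-! ### Undirected models -/

section Undirected

variable {V : Type*} {G : SimpleGraph V} {A M F : Set V}

/-- `v` is reached from `A` by a walk that avoids `M`. -/
inductive Reach (G : SimpleGraph V) (A M : Set V) : V → Prop
  | start {a : V} : a ∈ A → a ∉ M → Reach G A M a
  | step {v w : V} : Reach G A M v → G.Adj v w → w ∉ M → Reach G A M w

theorem Reach.notMem {v : V} (h : Reach G A M v) : v ∉ M := by cases h <;> assumption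

theorem Reach.mono {N : Set V} (hN : N ⊆ M) {v : V} (h : Reach G A M v) : Reach G A N v := by
  induction h with
  | start h1 h2 => exact .start h1 fun h => h2 (hN h)
  | step _ h2 h3 ih => exact .step ih h2 fun h => h3 (hN h)

/-- The walk is cut at its first vertex in `F`, if there is one. -/
theorem Reach.truncate (F : Set V) {v : V} (h : Reach G A M v) :
    (∃ f ∈ F, Reach G A (M ∪ (F \ {f})) f) ∨ Reach G A (M ∪ F) v := by
  have hmono : ∀ f, M ∪ (F \ {f}) ⊆ M ∪ F := fun f =>
    Set.union_subset_union_right _ Set.sdiff_subset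
  induction h with
  | @start a h1 h2 =>
    by_cases ha : a ∈ F
    · exact Or.inl ⟨a, ha, .start h1 (by simp [h2])⟩
    · exact Or.inr (.start h1 (by simp [h2, ha]))
  | @step v w _ h2 h3 ih =>
    rcases ih with ih | ih
    · exact Or.inl ih
    by_cases hw : w ∈ F
    · exact Or.inl ⟨w, hw, .step (ih.mono (hmono w)) h2 (by simp [h3])⟩
    · exact Or.inr (.step ih h2 (by simp [h3, hw]))

theorem separated_iff {D : Set V} [Fintype V] [DecidableEq V] :
    Separated G A D M ↔ ∀ d ∈ D, ¬ Reach G A M d := by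
  constructor
  · intro h d hd hr
    have : ∃ a ∈ A, ∃ P : G.Walk a d, ∀ v ∈ P.support, v ∉ M := by
      clear hd
      induction hr with
      | @start a h1 h2 => exact ⟨a, h1, .nil, by simpa using h2⟩
      | @step v w _ h2 h3 ih =>
        obtain ⟨a, ha, P, hP⟩ := ih
        refine ⟨a, ha, P.concat h2, fun u hu => ?_⟩
        rw [SimpleGraph.Walk.support_concat] at hu
        rcases List.mem_append.1 hu with hu | hu
        · exact hP u hu
        · rwa [List.mem_singleton.1 hu]
    obtain ⟨a, ha, P, hP⟩ := this
    obtain ⟨v, hv, hvM⟩ := h a ha d hd P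
    exact hP v hv hvM
  · intro h x hx y hy P
    by_contra! hP
    have : ∀ {x y : V} (P : G.Walk x y), (∀ v ∈ P.support, v ∉ M) → Reach G A M x →
        Reach G A M y := by
      intro x y P
      induction P with
      | nil => exact fun _ hr => hr
      | cons hadj P ih =>
        intro hP hr
        simp only [SimpleGraph.Walk.support_cons, List.mem_cons, forall_eq_or_imp] at hP
        exact ih hP.2 (.step hr hadj (hP.2 _ P.start_mem_support))
    exact h y hy (this P hP (.start hx (hP x P.start_mem_support)))

variable [Fintype V] [DecidableEq V]

theorem condIndep_of_not_reach {𝒳 : V → Type} [∀ v, Fintype (𝒳 v)] {p : (∀ v, 𝒳 v) → ℝ}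
    (hp : UndirectedFactorizes G 𝒳 p) {D : Set V} (h : ∀ d ∈ D, ¬ Reach G A M d) :
    CondIndep p A D M := by
  classical
  obtain ⟨-, 𝒞, ψ, Z, hcl, -, hψ⟩ := hp
  -- A clique that contains a reached vertex lies in `U ∪ M`, since its other vertices are adjacent
  -- to that vertex.
  refine condIndep_of_factor (U := {v | Reach G A M v})
    (f := fun x => 1 / Z * ∏ K ∈ 𝒞 with ∃ v ∈ K, Reach G A M v, ψ K (fun v => x v))
    (g := fun x => ∏ K ∈ 𝒞 with ¬ ∃ v ∈ K, Reach G A M v, ψ K (fun v => x v))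
    (fun x => ?_) (fun x y hxy => ?_) (fun x y hxy => ?_) (fun a ha => ?_) ?_ ?_
  · rw [hψ, mul_assoc, Finset.prod_filter_mul_prod_filter_not]
  · refine congrArg _ (Finset.prod_congr rfl fun K hK => congrArg _ (funext fun w => hxy w ?_))
    obtain ⟨hK, v, hv, hr⟩ := Finset.mem_filter.1 hK
    by_cases hw : (w : V) ∈ M
    · exact Or.inr hw
    · by_cases hvw : v = w
      · exact Or.inl (hvw ▸ hr)
      · exact Or.inl (Reach.step hr (hcl K hK hv w.2 hvw) hw)
  · refine Finset.prod_congr rfl fun K hK => congrArg _ (funext fun w => hxy w ?_)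
    exact fun hr => (Finset.mem_filter.1 hK).2 ⟨w, w.2, hr⟩
  · by_cases haM : a ∈ M
    · exact Or.inr haM
    · exact Or.inl (.start ha haM)
  · exact Set.disjoint_left.2 h
  · exact Set.disjoint_left.2 fun m hm hr => hr.notMem hm

/-- The uniform distribution on the two configurations that vanish outside a connected set `R`
and are constant on it factorizes. -/
theorem exists_undirectedFactorizes_constant (G : SimpleGraph V) {R : Set V} {b : V}
    (hb : b ∈ R) (hconn : ∀ x : V → Prop,
      (∀ u ∈ R, ∀ v ∈ R, G.Adj u v → x u = x v) → ∀ v ∈ R, x v = x b) :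
    ∃ p : (V → Prop) → ℝ, UndirectedFactorizes G (fun _ => Prop) p ∧
      ∀ x, p x ≠ 0 ↔ x = (· ∈ R) ∨ x = fun _ => False := by
  classical
  let x₁ : V → Prop := (· ∈ R)
  let x₀ : V → Prop := fun _ => False
  have hne : x₁ ≠ x₀ := fun h => (congrFun h b ▸ hb : x₀ b)
  let p : (V → Prop) → ℝ := fun x => if x = x₁ ∨ x = x₀ then 1 / 2 else 0
  refine ⟨p, ⟨⟨fun x => ?_, ?_⟩, ?_⟩, fun x => ?_⟩
  · simp only [p]; split_ifs <;> norm_num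
  · simp only [p]
    rw [← Finset.sum_filter, Finset.sum_const]
    have : (Finset.univ.filter fun x => x = x₁ ∨ x = x₀) = {x₁, x₀} := by ext; simp
    rw [this, Finset.card_pair hne]
    norm_num
  -- Singletons force the value `False` outside `R` and edges force constancy on `R`; `Z = 2` counts
  -- the surviving configurations.
  · refine ⟨Finset.univ.filter fun K => G.IsClique K, fun K y =>
      if (∀ u v : K, (u : V) ∈ R → (v : V) ∈ R → y u = y v) ∧ (∀ u : K, (u : V) ∉ R → ¬ y u)
      then 1 else 0, 2, fun K hK => (Finset.mem_filter.1 hK).2, fun K _ y => ?_, fun x => ?_⟩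
    · positivity
    rw [Finset.prod_ite_zero]
    simp only [Finset.prod_const_one, p]
    have : (x = x₁ ∨ x = x₀) ↔ ∀ K ∈ Finset.univ.filter (fun K => G.IsClique K),
        (∀ u v : K, (u : V) ∈ R → (v : V) ∈ R → x u = x v) ∧
          (∀ u : K, (u : V) ∉ R → ¬ x u) := by
      constructor
      · rintro (rfl | rfl) K -
        · exact ⟨fun u v hu hv => propext ⟨fun _ => hv, fun _ => hu⟩, fun u hu => hu⟩
        · exact ⟨fun u v hu hv => rfl, fun u hu => id⟩
      · intro h
        have hout : ∀ u ∉ R, ¬ x u := fun u hu => (h {u} (by simp)).2 ⟨u, rfl⟩ hu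
        have hin := hconn x fun u hu v hv huv =>
          (h {u, v} (by simp [huv])).1 ⟨u, by simp⟩ ⟨v, by simp⟩ hu hv
        by_cases hxb : x b
        · left
          funext v
          by_cases hv : v ∈ R
          · rw [hin v hv]; exact propext ⟨fun _ => hv, fun _ => hxb⟩
          · exact propext ⟨fun hx => (hout v hv hx).elim, fun hR => (hv hR).elim⟩
        · right
          funext v
          refine propext ⟨fun hx => ?_, False.elim⟩
          by_cases hv : v ∈ R
          · rw [hin v hv] at hx; exact hxb hx
          · exact hout v hv hx
    simp only [← this]
    split_ifs <;> norm_num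
  · simp only [p, x₁, x₀]
    split_ifs with h <;> simp [h]

theorem not_indep_of_reach {D : Set V} {d : V} (hd : d ∈ D) (h : Reach G A M d) :
    ¬ Indep (UndirectedFactorizes G) A D M := by
  intro hI
  -- A single starting vertex is needed: the set reached from all of `A` may be disconnected.
  obtain ⟨a, ha, hd'⟩ : ∃ a ∈ A, Reach G {a} M d := by
    clear hI hd
    induction h with
    | @start a h1 h2 => exact ⟨a, h1, .start rfl h2⟩
    | step _ h2 h3 ih => obtain ⟨a, ha, ih⟩ := ih; exact ⟨a, ha, .step ih h2 h3⟩
  have haR : Reach G {a} M a := by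
    clear hd hI h
    induction hd' with
    | @start a h1 h2 => cases h1; exact .start rfl h2
    | step _ _ _ ih => exact ih
  obtain ⟨p, hp, hsupp⟩ := exists_undirectedFactorizes_constant G
      (R := {v | Reach G {a} M v}) haR <| by
    intro x hx v hv
    induction hv with
    | start h1 => cases h1; rfl
    | step h1 h2 h3 ih => exact (hx _ h1 _ (Reach.step h1 h2 h3) h2).symm.trans ih
  refine not_condIndep_of_support hp.1.1 ha hd ((hsupp _).2 (Or.inl rfl))
    ((hsupp _).2 (Or.inr rfl)) (fun v hv => ?_) (fun z hz _ hza hzd => ?_) (hI _ p hp)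
  · exact propext ⟨fun hr => hr.notMem hv, False.elim⟩
  · rcases (hsupp z).1 hz with rfl | rfl
    · exact hzd.mp hd'
    · exact hza.mpr haR

theorem isConnectivity_reach (G : SimpleGraph V) (B : Set V) :
    IsConnectivity (UndirectedFactorizes G) B (Reach G B) where
  indep_iff _ _ := ⟨fun h _ hd hr => not_indep_of_reach hd hr h,
    fun h _ _ _ hp => condIndep_of_not_reach hp h⟩
  notMem := Reach.notMem
  shrink h := Or.inl (h.mono Set.subset_union_left)
  truncate F h := h.truncate F

end Undirected

/-! ### Directed models: active trails as a travelling ball -/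

section Directed

variable {V : Type*} {G : Digraph V} {A D M F : Set V}

/-- The vertices reached from `A` by a trail that is active given `M`, whose v-structures all lie
in `M`. The first index tells the direction of the last arc: `false` if it points to the last
vertex, `true` if it leaves it (or if the trail has no arc). -/
inductive Ball (G : Digraph V) (A M : Set V) : Bool → V → Prop
  | start {a : V} : a ∈ A → a ∉ M → Ball G A M true a
  | up_up {u v : V} : Ball G A M true v → G.Adj u v → u ∉ M → Ball G A M true u
  | up_down {v w : V} : Ball G A M true v → G.Adj v w → Ball G A M false w
  | down_down {v w : V} : Ball G A M false v → v ∉ M → G.Adj v w → Ball G A M false w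
  | down_up {u v : V} : Ball G A M false v → v ∈ M → G.Adj u v → u ∉ M → Ball G A M true u

/-- `d` is reached from `A` by an active trail given `M`. -/
def DConn (G : Digraph V) (A M : Set V) (d : V) : Prop := d ∉ M ∧ ∃ s, Ball G A M s d

theorem Ball.notMem {v : V} (h : Ball G A M true v) : v ∉ M := by cases h <;> assumption

/-- Only a bounce at a v-structure in `F \ M` can become illegal, and the first such v-structure is
itself connected given `M`. -/
theorem Ball.shrink {s : Bool} {v : V} (h : Ball G A (M ∪ F) s v) :
    Ball G A M s v ∨ ∃ f ∈ F, DConn G A M f := by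
  have hM : ∀ {v}, v ∉ M ∪ F → v ∉ M := fun h h' => h (Or.inl h')
  induction h with
  | start h1 h2 => exact Or.inl (.start h1 (hM h2))
  | up_up _ h2 h3 ih => exact ih.imp_left fun ih => .up_up ih h2 (hM h3)
  | up_down _ h2 ih => exact ih.imp_left fun ih => .up_down ih h2
  | down_down _ h2 h3 ih => exact ih.imp_left fun ih => .down_down ih (hM h2) h3
  | @down_up u v _ h2 h3 h4 ih =>
    rcases ih with ih | ih
    · by_cases hv : v ∈ M
      · exact Or.inl (.down_up ih hv h3 (hM h4))
      · exact Or.inr ⟨v, h2.resolve_left hv, hv, _, ih⟩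
    · exact Or.inr ih

theorem DConn.shrink {d : V} (h : DConn G A (M ∪ F) d) :
    DConn G A M d ∨ ∃ f ∈ F, DConn G A M f := by
  obtain ⟨h1, s, h2⟩ := h
  exact h2.shrink.imp_left fun h3 => ⟨fun h => h1 (Or.inl h), s, h3⟩

/-- A ball that could move on to `f ∉ M` if `f` were not observed gives a connection to `f`. -/
theorem Ball.dconn_of_step {s : Bool} {v f : V} (hf : f ∈ F) (hfM : f ∉ M)
    (h : Ball G A (M ∪ F) s v)
    (hstep : Ball G A (M ∪ (F \ {f})) s v → ∃ s', Ball G A (M ∪ (F \ {f})) s' f) :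
    DConn G A (M ∪ (F \ {f})) f := by
  -- Only `f` is forgotten: either the ball keeps its way and moves on to `f`, or it already bounced
  -- at `f`, which is then connected.
  have e : M ∪ F = (M ∪ (F \ {f})) ∪ {f} := by
    rw [Set.union_assoc, Set.sdiff_union_self, Set.union_eq_self_of_subset_right (t := {f})]
    simpa using hf
  rw [e] at h
  rcases h.shrink with h | ⟨g, rfl, h⟩
  · exact ⟨by simp [hfM], hstep h⟩
  · exact h

theorem Ball.truncate (F : Set V) {s : Bool} {v : V} (h : Ball G A M s v) :
    (∃ f ∈ F, DConn G A (M ∪ (F \ {f})) f) ∨ Ball G A (M ∪ F) s v := by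
  have hM : ∀ {f}, f ∉ M → f ∉ M ∪ (F \ {f}) := fun h => by simp [h]
  induction h with
  | @start a h1 h2 =>
    by_cases ha : a ∈ F
    · exact Or.inl ⟨a, ha, hM h2, _, .start h1 (hM h2)⟩
    · exact Or.inr (.start h1 (by simp [h2, ha]))
  | @up_up u v _ h2 h3 ih =>
    rcases ih with ih | ih
    · exact Or.inl ih
    by_cases hu : u ∈ F
    · exact Or.inl ⟨u, hu, ih.dconn_of_step hu h3 fun h => ⟨_, .up_up h h2 (hM h3)⟩⟩
    · exact Or.inr (.up_up ih h2 (by simp [h3, hu]))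
  | up_down _ h2 ih => exact ih.imp_right fun ih => .up_down ih h2
  | @down_down v w _ h2 h3 ih =>
    rcases ih with ih | ih
    · exact Or.inl ih
    by_cases hv : v ∈ F
    · exact Or.inl ⟨v, hv, ih.dconn_of_step hv h2 fun h => ⟨_, h⟩⟩
    · exact Or.inr (.down_down ih (by simp [h2, hv]) h3)
  | @down_up u v _ h2 h3 h4 ih =>
    rcases ih with ih | ih
    · exact Or.inl ih
    by_cases hu : u ∈ F
    · exact Or.inl ⟨u, hu, ih.dconn_of_step hu h4
        fun h => ⟨_, .down_up h (Or.inl h2) h3 (hM h4)⟩⟩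
    · exact Or.inr (.down_up ih (Or.inl h2) h3 (by simp [h4, hu]))

theorem DConn.truncate {d : V} (F : Set V) (h : DConn G A M d) :
    (∃ f ∈ F, DConn G A (M ∪ (F \ {f})) f) ∨ DConn G A (M ∪ F) d := by
  obtain ⟨h1, s, h2⟩ := h
  rcases h2.truncate F with h3 | h3
  · exact Or.inl h3
  by_cases hd : d ∈ F
  · exact Or.inl ⟨d, hd, h3.dconn_of_step hd h1 fun h => ⟨_, h⟩⟩
  · exact Or.inr ⟨by simp [h1, hd], s, h3⟩

/-- A ball that moves down from an ancestor of `M` bounces back. -/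
theorem Ball.bounce {v m : V} (hm : m ∈ M) (hvm : Relation.ReflTransGen G.Adj v m) :
    ∀ {u : V}, Ball G A M false v → G.Adj u v → u ∉ M → Ball G A M true u := by
  induction hvm using Relation.ReflTransGen.head_induction_on with
  | refl => exact fun h h1 h2 => .down_up h hm h1 h2
  | @head v w hvw _ ih =>
    intro u h h1 h2
    by_cases hv : v ∈ M
    · exact .down_up h hv h1 h2
    · exact .up_up (ih (.down_down h hv hvw) hvw hv) h1 h2

/-- The directed path from `u` is followed down. It meets `M`, where the ball bounces, or ends in
`A`, where a new ball starts; ending unobserved in `D` is excluded. The ball then climbs back to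
`u`. -/
theorem Ball.up_of_down {u z : V} (hz : z ∈ A ∪ D ∪ M) (h : ∀ d ∈ D, ¬ DConn G A M d)
    (huz : Relation.ReflTransGen G.Adj u z) (hu : Ball G A M false u) (huM : u ∉ M) :
    Ball G A M true u := by
  induction huz using Relation.ReflTransGen.head_induction_on with
  | refl =>
    rcases hz with (hz | hz) | hz
    · exact .start hz huM
    · exact (h z hz ⟨huM, _, hu⟩).elim
    · exact (huM hz).elim
  | @head u w huw _ ih =>
    have hw : Ball G A M false w := .down_down hu huM huw
    by_cases hwM : w ∈ M
    · exact .down_up hw hwM huw huM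
    · exact .up_up (ih hw hwM) huw huM

/-- A trail from `A` that is active given `M` up to its last vertex, with v-structures in `M`. -/
def IsOpenTrail (G : Digraph V) (A M : Set V) (k : ℕ) (t : ℕ → V) : Prop :=
  IsTrail G k t ∧ t 0 ∈ A ∧ ∀ i < k, IsVStructure G k t i ↔ t i ∈ M

theorem IsOpenTrail.extend {k : ℕ} {t : ℕ → V} (h : IsOpenTrail G A M k t) {w : V}
    (hw : G.Adj (t k) w ∨ G.Adj w (t k))
    (hk : (0 < k ∧ G.Adj (t (k - 1)) (t k) ∧ G.Adj w (t k)) ↔ t k ∈ M) :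
    ∃ t', IsOpenTrail G A M (k + 1) t' ∧ t' k = t k ∧ t' (k + 1) = w := by
  have ht' : ∀ i ≤ k, Function.update t (k + 1) w i = t i := fun i hi =>
    Function.update_of_ne (by omega) _ _
  have hw' : Function.update t (k + 1) w (k + 1) = w := Function.update_self _ _ _
  refine ⟨Function.update t (k + 1) w, ⟨fun i hi => ?_, ?_, fun i hi => ?_⟩, ht' k le_rfl, hw'⟩
  · rcases Nat.lt_succ_iff_lt_or_eq.1 hi with hi | rfl
    · rw [ht' i hi.le, ht' (i + 1) hi]; exact h.1 i hi
    · rw [ht' i le_rfl, hw']; exact hw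
  · rw [ht' 0 (Nat.zero_le k)]; exact h.2.1
  · unfold IsVStructure
    rcases Nat.lt_succ_iff_lt_or_eq.1 hi with hi' | rfl
    · rw [ht' i hi'.le, ht' (i + 1) hi', ht' (i - 1) (by omega), ← h.2.2 i hi', IsVStructure]
      simp only [hi, hi']
    · rw [ht' i le_rfl, hw', ht' (i - 1) (by omega), ← hk]
      simp

theorem Acyclic.asymm (hG : Acyclic G) {u v : V} (h : G.Adj u v) :
    ¬ G.Adj v u :=
  fun h' => hG u (.tail (.single h) h')

/-- The values allowed at a vertex `v`, given the values `y` of its parents, in a model of bits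
that travel along the trail `t 0, …, t k`: the `i`-th bit lives at `t i` and is copied from the
arcs of the trail that enter `t i`, or, at a v-structure, tells whether the two incoming bits
differ. -/
def TrailConstraint (G : Digraph V) (k : ℕ) (t : ℕ → V) (v : V) (a : Fin (k + 1) → Prop)
    (y : {u // G.Adj u v} → Fin (k + 1) → Prop) : Prop :=
  ∀ i : Fin (k + 1), (v ≠ t i → ¬ a i) ∧ (v = t i →
    (IsVStructure G k t i → (a i ↔ ∃ (j l : Fin (k + 1)) (hj : G.Adj (t j) v)
      (hl : G.Adj (t l) v), (j : ℕ) + 1 = i ∧ (i : ℕ) + 1 = l ∧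
        ¬ (y ⟨t j, hj⟩ j ↔ y ⟨t l, hl⟩ l))) ∧
    (¬ IsVStructure G k t i → ∀ (j : Fin (k + 1)) (hj : G.Adj (t j) v),
      (j : ℕ) + 1 = i ∨ (i : ℕ) + 1 = j → (a i ↔ y ⟨t j, hj⟩ j)))

theorem exists_trailConstraint (G : Digraph V) (k : ℕ) (t : ℕ → V) (v : V)
    (y : {u // G.Adj u v} → Fin (k + 1) → Prop) : ∃ a, TrailConstraint G k t v a y := by
  suffices h : ∀ i : Fin (k + 1), ∃ b : Prop, (v ≠ t i → ¬ b) ∧ (v = t i →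
      (IsVStructure G k t i → (b ↔ ∃ (j l : Fin (k + 1)) (hj : G.Adj (t j) v)
        (hl : G.Adj (t l) v), (j : ℕ) + 1 = i ∧ (i : ℕ) + 1 = l ∧
          ¬ (y ⟨t j, hj⟩ j ↔ y ⟨t l, hl⟩ l))) ∧
      (¬ IsVStructure G k t i → ∀ (j : Fin (k + 1)) (hj : G.Adj (t j) v),
        (j : ℕ) + 1 = i ∨ (i : ℕ) + 1 = j → (b ↔ y ⟨t j, hj⟩ j))) by
    choose a ha using h
    exact ⟨a, ha⟩
  intro i
  by_cases hv : v = t i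
  · subst hv
    by_cases hi : IsVStructure G k t i
    · exact ⟨_, fun h => absurd rfl h, fun _ => ⟨fun _ => Iff.rfl, fun h => absurd hi h⟩⟩
    · by_cases hj : ∃ (j : Fin (k + 1)) (_ : G.Adj (t j) (t i)),
          (j : ℕ) + 1 = i ∨ (i : ℕ) + 1 = j
      · obtain ⟨j, hj, hji⟩ := hj
        refine ⟨y ⟨t j, hj⟩ j, fun h => absurd rfl h, fun _ => ⟨fun h => absurd h hi,
          fun _ l hl hli => ?_⟩⟩
        -- Two different parents of `t i` next to it on the trail would make position `i` a
        -- v-structure, so at most one bit is to be copied.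
        have : j = l := by
          by_contra hne
          have hne : (j : ℕ) ≠ l := fun h => hne (Fin.ext h)
          refine hi ⟨by omega, by omega, ?_⟩
          rcases hji with hji | hji <;> rcases hli with hli | hli
          · omega
          · rw [hli, ← hji, Nat.add_sub_cancel, hji]; exact ⟨hj, hl⟩
          · rw [hji, ← hli, Nat.add_sub_cancel, hli]; exact ⟨hl, hj⟩
          · omega
        subst this
        rfl
      · exact ⟨False, fun _ => id, fun _ => ⟨fun h => absurd h hi,
          fun _ l hl hli => (hj ⟨l, hl, hli⟩).elim⟩⟩
  · exact ⟨False, fun _ => id, fun h => absurd h hv⟩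

/-- Along a trail whose v-structures carry the bit `False`, all other bits agree. -/
theorem bit_eq_of_trailConstraint (hG : Acyclic G) {k : ℕ} {t : ℕ → V} (ht : IsTrail G k t)
    {x : V → Fin (k + 1) → Prop} (hx : ∀ v, TrailConstraint G k t v (x v) (fun u => x u))
    (hv : ∀ i : Fin (k + 1), IsVStructure G k t i → ¬ x (t i) i) :
    ∀ i : Fin (k + 1), ¬ IsVStructure G k t i → (x (t i) i ↔ x (t 0) 0) := by
  have hcopy : ∀ i j : Fin (k + 1), ¬ IsVStructure G k t i →
      (j : ℕ) + 1 = i ∨ (i : ℕ) + 1 = j → G.Adj (t j) (t i) → (x (t i) i ↔ x (t j) j) :=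
    fun i j hi hij hadj => ((hx (t i) i).2 rfl).2 hi j hadj hij
  suffices h : ∀ n (hn : n < k + 1), ¬ IsVStructure G k t n → (x (t n) ⟨n, hn⟩ ↔ x (t 0) 0) from
    fun i hi => h i i.2 hi
  intro n
  induction n using Nat.strong_induction_on with
  | _ n ih =>
  intro hn hnv
  rcases Nat.eq_zero_or_pos n with rfl | hpos
  · rfl
  obtain ⟨m, rfl⟩ : ∃ m, n = m + 1 := ⟨n - 1, by omega⟩
  by_cases hm : IsVStructure G k t m
  -- The bit `False` at the v-structure `l + 1` says that the bits at `l` and `l + 2` agree; by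
  -- acyclicity `l` is not a v-structure, so induction applies to it.
  · obtain ⟨l, rfl⟩ : ∃ l, m = l + 1 := ⟨m - 1, by have := hm.1; omega⟩
    have hadj := hm.2.2
    rw [Nat.add_sub_cancel] at hadj
    have hl : ¬ IsVStructure G k t l := fun hl => hG.asymm hadj.1 hl.2.2.2
    rw [← ih l (by omega) (by omega) hl]
    have h1 := ((hx (t (l + 1)) ⟨l + 1, by omega⟩).2 rfl).1 hm
    have h2 := mt h1.2 (hv ⟨l + 1, by omega⟩ hm)
    by_contra hne
    exact h2 ⟨⟨l, by omega⟩, ⟨l + 1 + 1, hn⟩, hadj.1, hadj.2, rfl, rfl, fun h => hne h.symm⟩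
  · rw [← ih m (by omega) (by omega) hm]
    rcases ht m (by omega) with hadj | hadj
    · exact hcopy ⟨m + 1, hn⟩ ⟨m, by omega⟩ hnv (Or.inl rfl) hadj
    · exact (hcopy ⟨m, by omega⟩ ⟨m + 1, hn⟩ hm (Or.inr rfl) hadj).symm

/-- The direction of the last arc is recorded because it decides whether the last vertex becomes a
v-structure when the trail is extended. -/
theorem Ball.exists_openTrail (hG : Acyclic G) {s : Bool} {v : V} (h : Ball G A M s v) :
    ∃ k t, IsOpenTrail G A M k t ∧ t k = v ∧ (s = true → 0 < k → G.Adj (t k) (t (k - 1))) ∧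
      (s = false → 0 < k ∧ G.Adj (t (k - 1)) (t k)) := by
  induction h with
  | @start a h1 h2 =>
    exact ⟨0, fun _ => a, ⟨fun i hi => absurd hi (Nat.not_lt_zero i), h1,
      fun i hi => absurd hi (Nat.not_lt_zero i)⟩, rfl, by simp, by simp⟩
  | @up_up u v hv h2 h3 ih =>
    obtain ⟨k, t, ht, rfl, hup, -⟩ := ih
    obtain ⟨t', ht', e1, e2⟩ := ht.extend (Or.inr h2)
      ⟨fun h => (hG.asymm h.2.1 (hup rfl h.1)).elim, fun h => (hv.notMem h).elim⟩
    refine ⟨k + 1, t', ht', e2, fun _ _ => ?_, by simp⟩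
    rw [e2, Nat.add_sub_cancel, e1]; exact h2
  | @up_down v w hv h2 ih =>
    obtain ⟨k, t, ht, rfl, hup, -⟩ := ih
    obtain ⟨t', ht', e1, e2⟩ := ht.extend (Or.inl h2)
      ⟨fun h => (hG.asymm h.2.2 h2).elim, fun h => (hv.notMem h).elim⟩
    refine ⟨k + 1, t', ht', e2, by simp, fun _ => ⟨Nat.succ_pos k, ?_⟩⟩
    rw [e2, Nat.add_sub_cancel, e1]; exact h2
  | @down_down v w hv h2 h3 ih =>
    obtain ⟨k, t, ht, rfl, -, hdown⟩ := ih
    obtain ⟨t', ht', e1, e2⟩ := ht.extend (Or.inl h3)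
      ⟨fun h => (hG.asymm h.2.2 h3).elim, fun h => (h2 h).elim⟩
    refine ⟨k + 1, t', ht', e2, by simp, fun _ => ⟨Nat.succ_pos k, ?_⟩⟩
    rw [e2, Nat.add_sub_cancel, e1]; exact h3
  | @down_up u v hv h2 h3 h4 ih =>
    obtain ⟨k, t, ht, rfl, -, hdown⟩ := ih
    obtain ⟨t', ht', e1, e2⟩ := ht.extend (Or.inr h3)
      ⟨fun _ => h2, fun _ => ⟨(hdown rfl).1, (hdown rfl).2, h3⟩⟩
    refine ⟨k + 1, t', ht', e2, fun _ _ => ?_, by simp⟩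
    rw [e2, Nat.add_sub_cancel, e1]; exact h3

/-- A v-structure that only has a descendant in `M` is replaced by a detour down to `M` and back
(`Ball.bounce`). -/
theorem ball_of_active (hG : Acyclic G) {k : ℕ} {t : ℕ → V} (ht : IsTrail G k t) (h0 : t 0 ∈ A)
    (hact : IsActive G k t M) :
    ∀ i ≤ k, ((0 < i → G.Adj (t i) (t (i - 1))) → Ball G A M true (t i)) ∧
      (0 < i → G.Adj (t (i - 1)) (t i) → Ball G A M false (t i)) := by
  intro i
  induction i with
  | zero =>
    refine fun _ => ⟨fun _ => .start h0 ((hact 0 (Nat.zero_le k)).1 fun h => ?_), by simp⟩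
    exact absurd h.1 (lt_irrefl 0)
  | succ i ih =>
    intro hi
    obtain ⟨ih1, ih2⟩ := ih (by omega)
    simp only [Nat.add_sub_cancel, Nat.succ_pos, true_implies]
    by_cases hin : 0 < i ∧ G.Adj (t (i - 1)) (t i)
    · have hb := ih2 hin.1 hin.2
      refine ⟨fun h => ?_, fun h => ?_⟩
      · obtain ⟨m, hm, hd⟩ := (hact i (by omega)).2 ⟨hin.1, by omega, hin.2, h⟩
        exact hb.bounce hm hd h ((hact (i + 1) hi).1 fun hv => hG.asymm h hv.2.2.1)
      · exact .down_down hb ((hact i (by omega)).1 fun hv => hG.asymm h hv.2.2.2) h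
    · have hb : Ball G A M true (t i) := ih1 fun hpos => by
        have := ht (i - 1) (by omega)
        rw [Nat.sub_add_cancel hpos] at this
        exact this.resolve_left fun h => hin ⟨hpos, h⟩
      exact ⟨fun h => .up_up hb h ((hact (i + 1) hi).1 fun hv => hG.asymm h hv.2.2.1),
        fun h => .up_down hb h⟩

theorem dSeparated_iff (hG : Acyclic G) : DSeparated G A D M ↔ ∀ d ∈ D, ¬ DConn G A M d := by
  constructor
  · rintro h d hd ⟨hdM, s, hb⟩
    obtain ⟨k, t, ht, rfl, -, -⟩ := hb.exists_openTrail hG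
    refine h k t ht.1 ht.2.1 hd fun i hi => ?_
    rcases hi.lt_or_eq with hi | rfl
    · exact ⟨fun hv => fun hm => hv ((ht.2.2 i hi).2 hm),
        fun hv => ⟨t i, (ht.2.2 i hi).1 hv, .refl⟩⟩
    · exact ⟨fun _ => hdM, fun hv => absurd hv.2.1 (lt_irrefl _)⟩
  · intro h k t ht h0 hk hact
    refine h _ hk ⟨(hact k le_rfl).1 fun hv => absurd hv.2.1 (lt_irrefl _), ?_⟩
    obtain ⟨h1, h2⟩ := ball_of_active hG ht h0 hact k le_rfl
    by_cases hin : 0 < k ∧ G.Adj (t (k - 1)) (t k)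
    · exact ⟨_, h2 hin.1 hin.2⟩
    · refine ⟨_, h1 fun hpos => ?_⟩
      have := ht (k - 1) (by omega)
      rw [Nat.sub_add_cancel hpos] at this
      exact this.resolve_left fun h => hin ⟨hpos, h⟩

variable [Fintype V] [DecidableEq V]

/-- The factors of a directed model outside an ancestral set `W` may be replaced by uniform ones
without changing the distribution of `X_W`. -/
theorem sum_mul_prod_conditional (hG : Acyclic G) {𝒳 : V → Type} [∀ v, Fintype (𝒳 v)]
    [∀ v, Nonempty (𝒳 v)] {q : ∀ v, 𝒳 v → (∀ u : {u // G.Adj u v}, 𝒳 u) → ℝ}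
    (hq : ∀ v y, ∑ a, q v a y = 1) (W : Set V) [DecidablePred (· ∈ W)]
    (hW : ∀ u v, G.Adj u v → v ∈ W → u ∈ W)
    (φ : (∀ v, 𝒳 v) → ℝ) (hφ : ∀ x y, (∀ v ∈ W, x v = y v) → φ x = φ y) :
    ∑ x, φ x * ∏ v, q v (x v) (fun u => x u) =
      ∑ x, φ x * ∏ v, if v ∈ W then q v (x v) (fun u => x u)
        else (Fintype.card (𝒳 v) : ℝ)⁻¹ := by
  classical
  induction hn : (Wᶜ).ncard generalizing W φ with
  | zero =>
    have : W = Set.univ := by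
      rw [Set.ncard_eq_zero (Set.toFinite _)] at hn
      exact Set.compl_empty_iff.1 hn
    subst this
    simp
  | succ n ih =>
    have hne : (Wᶜ).Nonempty := Set.nonempty_of_ncard_ne_zero (by omega)
    have hirr : Std.Irrefl (Relation.TransGen G.Adj) := ⟨hG⟩
    -- A vertex outside `W` with no ancestor outside `W`: adding it keeps `W` ancestral, and the
    -- remaining factors do not involve its coordinate.
    obtain ⟨v, hvW, hmin⟩ := (Finite.wellFounded_of_trans_of_irrefl
      (Relation.TransGen G.Adj)).has_min _ hne
    have hpar : ∀ u, G.Adj u v → u ∈ W := fun u hu => by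
      by_contra huW
      exact hmin u huW (.single hu)
    have hne_v : ∀ u ∈ W, u ≠ v := fun u hu h => hvW (h ▸ hu)
    have hcard : ((insert v W)ᶜ).ncard = n := by
      have e : (insert v W)ᶜ = Wᶜ \ {v} := by ext u; simp [and_comm]
      rw [e, Set.ncard_sdiff_singleton_of_mem hvW, hn, Nat.add_sub_cancel]
    rw [ih (insert v W) (fun u w huw hw => hw.elim
      (fun h => Or.inr (hpar u (h ▸ huw))) fun h => Or.inr (hW u w huw h)) φ
      (fun x y h => hφ x y fun u hu => h u (Or.inr hu)) hcard]
    have hsplit : ∀ x : ∀ v, 𝒳 v,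
        (∏ u, if u ∈ insert v W then q u (x u) (fun w => x w)
            else (Fintype.card (𝒳 u) : ℝ)⁻¹) =
          (∏ u ∈ Finset.univ.erase v, if u ∈ W then q u (x u) (fun w => x w)
            else (Fintype.card (𝒳 u) : ℝ)⁻¹) * q v (x v) (fun w => x w) := by
      intro x
      rw [← Finset.prod_erase_mul _ _ (Finset.mem_univ v), if_pos (Set.mem_insert v W)]
      congr 1
      refine Finset.prod_congr rfl fun u hu => ?_
      have huv : u ≠ v := Finset.ne_of_mem_erase hu
      simp [huv]
    have hsplit' : ∀ x : ∀ v, 𝒳 v,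
        (∏ u, if u ∈ W then q u (x u) (fun w => x w)
            else (Fintype.card (𝒳 u) : ℝ)⁻¹) =
          (∏ u ∈ Finset.univ.erase v, if u ∈ W then q u (x u) (fun w => x w)
            else (Fintype.card (𝒳 u) : ℝ)⁻¹) * (Fintype.card (𝒳 v) : ℝ)⁻¹ := by
      intro x
      rw [← Finset.prod_erase_mul _ _ (Finset.mem_univ v), if_neg hvW]
    simp only [hsplit, hsplit', ← mul_assoc]
    refine sum_mul_conditional v (fun x a => ?_) (fun x => ?_)
    · have hu : ∀ u ∈ W, Function.update x v a u = x u := fun u hu =>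
        Function.update_of_ne (hne_v u hu) _ _
      rw [hφ _ x hu]
      congr 1
      refine Finset.prod_congr rfl fun u _ => ?_
      split_ifs with huW
      · rw [hu u huW]
        exact congrArg _ (funext fun w => hu w (hW w u w.2 huW))
      · rfl
    · rw [← hq v fun w => x w]
      refine Finset.sum_congr rfl fun a _ => ?_
      rw [Function.update_self]
      exact congrArg _ (funext fun w => Function.update_of_ne (hne_v w (hpar w w.2)) _ _)

theorem prob_eq_of_sum_eq {𝒳 : V → Type} [∀ v, Fintype (𝒳 v)] {p p' : (∀ v, 𝒳 v) → ℝ}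
    {W : Set V} (h : ∀ φ : (∀ v, 𝒳 v) → ℝ, (∀ x y, (∀ v ∈ W, x v = y v) → φ x = φ y) →
      ∑ x, φ x * p x = ∑ x, φ x * p' x)
    {S : Set (∀ v, 𝒳 v)} (hS : ∀ x y, (∀ v ∈ W, x v = y v) → (x ∈ S ↔ y ∈ S)) :
    prob p S = prob p' S := by
  classical
  have := h (S.indicator 1) fun x y hxy => by simp [Set.indicator_apply, hS x y hxy]
  simpa [prob, Set.indicator_apply] using this

theorem condIndep_of_not_dconn (hG : Acyclic G) {𝒳 : V → Type} [∀ v, Fintype (𝒳 v)]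
    {p : (∀ v, 𝒳 v) → ℝ} (hp : DirectedFactorizes G 𝒳 p) (h : ∀ d ∈ D, ¬ DConn G A M d) :
    CondIndep p A D M := by
  classical
  obtain ⟨hsimp, q, hq, hpq⟩ := hp
  have hne : ∀ v, Nonempty (𝒳 v) := by
    by_contra! hne
    obtain ⟨v, hv⟩ := hne
    have : IsEmpty (∀ v, 𝒳 v) := ⟨fun x => hv.elim (x v)⟩
    simpa using hsimp.2
  -- All events concern the ancestral set `W`. Uniform factors outside it avoid passing to a
  -- marginal on a smaller product space.
  let W : Set V := {w | ∃ z ∈ A ∪ D ∪ M, Relation.ReflTransGen G.Adj w z}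
  have hWanc : ∀ u v, G.Adj u v → v ∈ W → u ∈ W := fun u v huv ⟨z, hz, hvz⟩ =>
    ⟨z, hz, .head huv hvz⟩
  have hAW : A ⊆ W := fun v hv => ⟨v, Or.inl (Or.inl hv), .refl⟩
  have hDW : D ⊆ W := fun v hv => ⟨v, Or.inl (Or.inr hv), .refl⟩
  have hMW : M ⊆ W := fun v hv => ⟨v, Or.inr hv, .refl⟩
  let r : V → (∀ v, 𝒳 v) → ℝ := fun v x =>
    if v ∈ W then q v (x v) (fun u => x u) else (Fintype.card (𝒳 v) : ℝ)⁻¹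
  have hsum : ∀ φ : (∀ v, 𝒳 v) → ℝ, (∀ x y, (∀ v ∈ W, x v = y v) → φ x = φ y) →
      ∑ x, φ x * p x = ∑ x, φ x * ∏ v, r v x := fun φ hφ => by
    simp only [hpq]
    exact sum_mul_prod_conditional hG (fun v y => (hq v y).2) W hWanc φ hφ
  let U : Set V := {u | u ∈ W ∧ Ball G A M true u}
  have hr : ∀ v x y, (v ∈ W → x v = y v) → (∀ u, v ∈ W → G.Adj u v → x u = y u) →
      r v x = r v y := by
    intro v x y h1 h2
    simp only [r]
    split_ifs with hv
    · rw [h1 hv]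
      exact congrArg _ (funext fun u => h2 u hv u.2)
    · rfl
  let T : V → Prop := fun v => v ∈ W ∧ (v ∈ U ∨ ∃ u, G.Adj u v ∧ u ∈ U)
  -- `T` selects the factors that involve a vertex of `U`. All vertices of such a factor lie in `U ∪
  -- M`: the ball climbs to the parents of `v`, after a bounce if `v ∈ M`.
  have hT : ∀ v, T v → (v ∈ M ∨ v ∈ U) ∧ ∀ u, G.Adj u v → u ∉ M → u ∈ U := by
    rintro v ⟨hvW, hv⟩
    have hup : v ∈ U → ∀ u, G.Adj u v → u ∉ M → u ∈ U := fun hv u huv huM =>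
      ⟨hWanc u v huv hvW, .up_up hv.2 huv huM⟩
    rcases hv with hv | ⟨u, huv, hu⟩
    · exact ⟨Or.inr hv, hup hv⟩
    · have hdown : Ball G A M false v := .up_down hu.2 huv
      by_cases hvM : v ∈ M
      · exact ⟨Or.inl hvM, fun w hwv hwM => ⟨hWanc w v hwv hvW, .down_up hdown hvM hwv hwM⟩⟩
      · obtain ⟨z, hz, hvz⟩ := hvW
        have : v ∈ U := ⟨⟨z, hz, hvz⟩, hdown.up_of_down hz h hvz hvM⟩
        exact ⟨Or.inr this, hup this⟩
  have hc : CondIndep (fun x => ∏ v, r v x) A D M := by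
    refine condIndep_of_factor (U := U) (f := fun x => ∏ v with T v, r v x)
      (g := fun x => ∏ v with ¬ T v, r v x)
      (fun x => (Finset.prod_filter_mul_prod_filter_not _ _ _).symm)
      (fun x y hxy => ?_) (fun x y hxy => ?_) (fun a ha => ?_) ?_ ?_
    · refine Finset.prod_congr rfl fun v hv => ?_
      obtain ⟨h1, h2⟩ := hT v (Finset.mem_filter.1 hv).2
      refine hr v x y (fun _ => hxy v h1.symm) fun u _ huv => hxy u ?_
      by_cases huM : u ∈ M
      · exact Or.inr huM
      · exact Or.inl (h2 u huv huM)
    · refine Finset.prod_congr rfl fun v hv => ?_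
      have hv := (Finset.mem_filter.1 hv).2
      exact hr v x y (fun hvW => hxy v fun hvU => hv ⟨hvW, Or.inl hvU⟩)
        fun u hvW huv => hxy u fun huU => hv ⟨hvW, Or.inr ⟨u, huv, huU⟩⟩
    · by_cases haM : a ∈ M
      · exact Or.inr haM
      · exact Or.inl ⟨hAW ha, .start ha haM⟩
    · exact Set.disjoint_left.2 fun d hd hdU => h d hd ⟨hdU.2.notMem, _, hdU.2⟩
    · exact Set.disjoint_left.2 fun m hm hmU => hmU.2.notMem hm
  have hev : ∀ {S : Set V} (a : ∀ v, 𝒳 v), S ⊆ W → ∀ x y : ∀ v, 𝒳 v, (∀ v ∈ W, x v = y v) →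
      (x ∈ coordEvent S a ↔ y ∈ coordEvent S a) := fun a hS x y hxy =>
    forall₂_congr fun v hv => by rw [hxy v (hS hv)]
  intro a d m
  have := hc a d m
  rwa [← prob_eq_of_sum_eq hsum (S := coordEvent A a ∩ coordEvent D d ∩ coordEvent M m)
      fun x y hxy => and_congr (and_congr (hev a hAW x y hxy) (hev d hDW x y hxy))
        (hev m hMW x y hxy),
    ← prob_eq_of_sum_eq hsum fun x y hxy => hev m hMW x y hxy,
    ← prob_eq_of_sum_eq hsum (S := coordEvent A a ∩ coordEvent M m)
      fun x y hxy => and_congr (hev a hAW x y hxy) (hev m hMW x y hxy),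
    ← prob_eq_of_sum_eq hsum (S := coordEvent D d ∩ coordEvent M m)
      fun x y hxy => and_congr (hev d hDW x y hxy) (hev m hMW x y hxy)] at this

/-- Drawing each variable uniformly from a nonempty set of values that depends on the values of
the parents defines a distribution that factorizes. -/
theorem exists_directedFactorizes_support (hG : Acyclic G) {𝒳 : V → Type} [∀ v, Fintype (𝒳 v)]
    [∀ v, Nonempty (𝒳 v)] (R : ∀ v, 𝒳 v → (∀ u : {u // G.Adj u v}, 𝒳 u) → Prop)
    (hR : ∀ v y, ∃ a, R v a y) :
    ∃ p, DirectedFactorizes G 𝒳 p ∧ ∀ x, p x ≠ 0 ↔ ∀ v, R v (x v) (fun u => x u) := by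
  classical
  let n : ∀ v, (∀ u : {u // G.Adj u v}, 𝒳 u) → ℕ := fun v y => (Finset.univ.filter (R v · y)).card
  have hn : ∀ v y, (n v y : ℝ) ≠ 0 := fun v y => by
    obtain ⟨a, ha⟩ := hR v y
    exact Nat.cast_ne_zero.2 (Finset.card_ne_zero_of_mem (a := a) (by simp [ha]))
  let q : ∀ v, 𝒳 v → (∀ u : {u // G.Adj u v}, 𝒳 u) → ℝ := fun v a y =>
    if R v a y then (n v y : ℝ)⁻¹ else 0
  have hq0 : ∀ v a y, 0 ≤ q v a y := fun v a y => by
    simp only [q]; split_ifs <;> positivity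
  have hq1 : ∀ v y, ∑ a, q v a y = 1 := fun v y => by
    simp only [q]
    rw [← Finset.sum_filter, Finset.sum_const, nsmul_eq_mul]
    exact mul_inv_cancel₀ (hn v y)
  refine ⟨fun x => ∏ v, q v (x v) (fun u => x u), ⟨⟨fun x => Finset.prod_nonneg fun v _ =>
    hq0 _ _ _, ?_⟩, q, fun v y => ⟨fun a => hq0 v a y, hq1 v y⟩, fun x => rfl⟩, fun x => ?_⟩
  -- With `W` empty, every conditional factor becomes uniform, so the total mass is one.
  · have := sum_mul_prod_conditional hG hq1 ∅ (fun _ _ _ h => h) (fun _ => 1) fun _ _ _ => rfl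
    simp only [one_mul, Set.mem_empty_iff_false, if_false] at this
    rw [this, Finset.sum_const, Finset.card_univ, Fintype.card_pi, nsmul_eq_mul, Nat.cast_prod,
      ← Finset.prod_mul_distrib]
    exact Finset.prod_eq_one fun v _ =>
      mul_inv_cancel₀ (Nat.cast_ne_zero.2 Fintype.card_ne_zero)
  · rw [Finset.prod_ne_zero_iff]
    refine ⟨fun h v => ?_, fun h v _ => ?_⟩
    · by_contra hv
      exact h v (Finset.mem_univ v) (if_neg hv)
    · simp only [q, if_pos (h v)]
      exact inv_ne_zero (hn _ _)

/-- Each position of an open trail carries its own bit, since vertices may repeat. The observed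
positions are exactly the v-structures. Observing `False` there forces the two end bits to agree,
while both common values remain possible. -/
theorem not_indep_of_dconn (hG : Acyclic G) {d : V} (hd : d ∈ D) (h : DConn G A M d) :
    ¬ Indep (DirectedFactorizes G) A D M := by
  intro hI
  obtain ⟨hdM, s, hb⟩ := h
  obtain ⟨k, t, ht, rfl, -, -⟩ := hb.exists_openTrail hG
  have hend : ∀ i : Fin (k + 1), IsVStructure G k t i ↔ t i ∈ M := fun i => by
    rcases (Nat.lt_succ_iff.1 i.2).lt_or_eq with hi | hi
    · exact ht.2.2 i hi
    · rw [hi]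
      exact ⟨fun hv => absurd hv.2.1 (lt_irrefl _), fun h => absurd h hdM⟩
  have hlast : ¬ IsVStructure G k t (Fin.last k) := fun hv => absurd hv.2.1 (lt_irrefl _)
  have hfirst : ¬ IsVStructure G k t (0 : Fin (k + 1)) := fun hv => absurd hv.1 (lt_irrefl _)
  obtain ⟨p, hp, hsupp⟩ := exists_directedFactorizes_support hG
    (𝒳 := fun _ => Fin (k + 1) → Prop) (TrailConstraint G k t) (exists_trailConstraint G k t)
  let x₁ : V → Fin (k + 1) → Prop := fun v i => v = t i ∧ ¬ IsVStructure G k t i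
  let x₀ : V → Fin (k + 1) → Prop := fun _ _ => False
  have hx₁ : p x₁ ≠ 0 := by
    refine (hsupp x₁).2 fun v i => ⟨fun h h' => h h'.1, ?_⟩
    rintro rfl
    refine ⟨fun hi => ⟨fun h => (h.2 hi).elim, ?_⟩, fun hi j hj hij => ?_⟩
    · rintro ⟨j, l, hj, hl, hji, hil, hne⟩
      refine (hne ⟨fun _ => ⟨rfl, fun hv => ?_⟩, fun _ => ⟨rfl, fun hv => ?_⟩⟩).elim
      · have := hv.2.2.1
        rw [← hil, Nat.add_sub_cancel, hil] at this
        exact hG.asymm hl this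
      · have := hv.2.2.2
        rw [hji] at this
        exact hG.asymm hj this
    · refine ⟨fun _ => ⟨rfl, fun hv => ?_⟩, fun _ => ⟨rfl, hi⟩⟩
      rcases hij with hij | hij
      · have := hv.2.2.2
        rw [hij] at this
        exact hG.asymm hj this
      · have := hv.2.2.1
        rw [← hij, Nat.add_sub_cancel, hij] at this
        exact hG.asymm hj this
  have hx₀ : p x₀ ≠ 0 := by
    refine (hsupp x₀).2 fun v i => ⟨fun _ => id, fun _ => ⟨fun _ => ⟨False.elim, ?_⟩,
      fun _ j _ _ => Iff.rfl⟩⟩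
    exact fun ⟨j, l, _, _, _, _, hne⟩ => hne Iff.rfl
  refine not_condIndep_of_support hp.1.1 ht.2.1 hd hx₁ hx₀ (fun v hv => ?_)
    (fun z hz hzM hza hzd => ?_) (hI _ p hp)
  · funext i
    exact propext ⟨fun h => h.2 ((hend i).2 (h.1 ▸ hv)), False.elim⟩
  · have hbit := bit_eq_of_trailConstraint hG ht.1 ((hsupp z).1 hz)
      (fun i hi => by rw [hzM _ ((hend i).1 hi)]; exact id) (Fin.last k) hlast
    have h0 : z (t 0) 0 := by rw [hza]; exact ⟨rfl, hfirst⟩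
    have h1 : ¬ z (t k) (Fin.last k) := by rw [hzd]; exact id
    exact h1 (hbit.2 h0)

theorem isConnectivity_dconn (hG : Acyclic G) (B : Set V) :
    IsConnectivity (DirectedFactorizes G) B (DConn G B) where
  indep_iff _ _ := ⟨fun h _ hd hr => not_indep_of_dconn hG hd hr h,
    fun h _ _ _ hp => condIndep_of_not_dconn hG hp h⟩
  notMem h := h.1
  shrink h := h.shrink
  truncate F h := h.truncate F

end Directed

end GraphicalModel

open GraphicalModel
theorem mainTheorem2 {V : Type*} [Fintype V] [DecidableEq V] (B C C' E : Set V)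
    (hB : B ∩ (C ∪ C') ⊆ E) :
    (∀ G : SimpleGraph V,
      IsMarkovBlanket (UndirectedFactorizes G) B C E (mb (UndirectedFactorizes G) C B E) ∧
      IsMarkovBlanket (UndirectedFactorizes G) B (C ∪ C') E
        (mb (UndirectedFactorizes G) (C ∪ C') B E) ∧
      (mb (UndirectedFactorizes G) (C ∪ C') B E = mb (UndirectedFactorizes G) C B E ↔
        Separated G C' B (C ∪ E))) ∧
    (∀ G : Digraph V, Acyclic G →
      IsMarkovBlanket (DirectedFactorizes G) B C E (mb (DirectedFactorizes G) C B E) ∧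
      IsMarkovBlanket (DirectedFactorizes G) B (C ∪ C') E
        (mb (DirectedFactorizes G) (C ∪ C') B E) ∧
      (mb (DirectedFactorizes G) (C ∪ C') B E = mb (DirectedFactorizes G) C B E ↔
        DSeparated G C' B (C ∪ E))) := by
  have hBC : B ∩ C ⊆ E := fun v hv => hB ⟨hv.1, Or.inl hv.2⟩
  refine ⟨fun G => ?_, fun G hG => ?_⟩
  · have h := isConnectivity_reach G B
    refine ⟨h.isMarkovBlanket hBC, h.isMarkovBlanket hB, ?_⟩
    -- The connection is now taken from `C'` instead of `B`, to match the order of the arguments in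
    -- the separation.
    rw [h.mb_union_eq_iff hB, (isConnectivity_reach G C').indep_iff, separated_iff]
  · have h := isConnectivity_dconn hG B
    refine ⟨h.isMarkovBlanket hBC, h.isMarkovBlanket hB, ?_⟩
    rw [h.mb_union_eq_iff hB, (isConnectivity_dconn hG C').indep_iff, dSeparated_iff hG]
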